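/- Let $G$ be a finite group and $p$ a prime. Let $\mathcal{O}(G)$ be the orbit category: its objects are the $G$-sets $G/H$ for all subgroups $H\le G$, and its morphisms are all $G$-maps. Let $\mathcal{O}_p^\circ(G)\subset\mathcal{O}(G)$ be the full subcategory on the $G/P$ with $P$ a non-trivial $p$-subgroup, and let $\iota:\mathcal{O}_p^\circ(G)\to\mathcal{O}(G)$ be the inclusion. Let $\mathcal{J}_{\mathrm{sipp}}$ be the Grothendieck topology on $\mathcal{O}(G)$ in which a sieve $S$ on $G/H$ is covering if and only if for every $u\in G/H$ there are a map $\alpha: V\to G/H$ in $S$ and a point $v\in V$ with $\alpha(v)=u$ such that the index $[\mathrm{Stab}_G(u):\mathrm{Stab}_G(v)]$ is prime to $p$. Let $\mathbb{I}:\mathrm{PSh}(\mathcal{O}_p^\circ(G))\to\mathrm{Sh}(\mathcal{O}(G),\mathcal{J}_{\mathrm{sipp}})$ be the geometric morphism induced by $\iota$. Its direct image functor $\mathbb{I}_*$ is right Kan extension along $\iota$. Write $R^1\mathbb{I}_*$ for the first right derived functor of $\mathbb{I}_*:\mathrm{PSh}(\mathcal{O}_p^\circ(G),\mathrm{Ab})\to\mathrm{Sh}((\mathcal{O}(G),\mathcal{J}_{\mathrm{sipp}}),\mathrm{Ab})$.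 Then for every presheaf of abelian groups $\mathfrak{M}$ on $\mathcal{O}_p^\circ(G)$, $$H^0\big((\mathcal{O}(G),\mathcal{J}_{\mathrm{sipp}}),R^1\mathbb{I}_*(\mathfrak{M})\big)=0\quad\text{and}\quad H^1\big((\mathcal{O}(G),\mathcal{J}_{\mathrm{sipp}}),R^1\mathbb{I}_*(\mathfrak{M})\big)=0,$$ where $H^i$ denotes sheaf cohomology on the site. -/

import Mathlib

open CategoryTheory

universe u

/-- A family `α i : V i → U` of maps of (left) `G`-sets is a sipp-covering (for the prime `p`) if
every `u : U` has a preimage `v` under some `α i` such that the index of the stabilizer of `v`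
in the stabilizer of `u` is prime to `p`. -/
def IsSippCovering {G : Type*} [Group G] (p : ℕ) {U : Type*} [MulAction G U]
    {ι : Type*} {V : ι → Type*} [∀ i, MulAction G (V i)] (α : ∀ i, V i →[G] U) : Prop :=
  ∀ u : U, ∃ (i : ι) (v : V i), α i v = u ∧
    p.Coprime ((MulAction.stabilizer G v).relIndex (MulAction.stabilizer G u))

/-- The orbit category `𝒪(G)`: its objects are the transitive `G`-sets `G ⧸ H`, for all subgroups
`H` of `G`, and its morphisms are all `G`-equivariant maps. -/
structure OrbitCategory (G : Type u) [Group G] : Type u where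
  /-- The subgroup `H` defining the `G`-set `G ⧸ H`. -/
  subgroup : Subgroup G

namespace OrbitCategory

variable {G : Type u} [Group G]

/-- The underlying `G`-set `G ⧸ H` of an object of the orbit category. -/
abbrev carrier (X : OrbitCategory G) : Type u := G ⧸ X.subgroup

instance : Category.{u} (OrbitCategory G) where
  Hom X Y := X.carrier →[G] Y.carrier
  id X := MulActionHom.id G
  comp f g := g.comp f

/-- A morphism of the orbit category, seen as a map of `G`-sets. -/
def toMap {X Y : OrbitCategory G} (f : X ⟶ Y) : X.carrier →[G] Y.carrier := f

/-- A sieve on `G ⧸ H` is a sipp-sieve if the maps in it form a sipp-covering of `G ⧸ H`. -/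
def IsSippSieve (p : ℕ) {X : OrbitCategory G} (S : Sieve X) : Prop :=
  IsSippCovering p (fun i : {f : Σ Y : OrbitCategory G, (Y ⟶ X) // S f.2} => toMap i.1.2)

@[ext]
lemma hom_ext {X Y : OrbitCategory G} {f g : X ⟶ Y}
    (h : toMap f ((1 : G) : X.carrier) = toMap g ((1 : G) : X.carrier)) : f = g := by
  refine MulActionHom.ext (f := toMap f) (g := toMap g) fun x => ?_
  induction x using QuotientGroup.induction_on with
  | H a =>
    have ha : ((a : G) : X.carrier) = a • ((1 : G) : X.carrier) := by
      simp
    rw [ha, map_smul, map_smul, h]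

/-- A point of `G ⧸ K` stabilized by `H` gives a morphism `G ⧸ H ⟶ G ⧸ K`. -/
lemma exists_hom {X Y : OrbitCategory G} (y : Y.carrier)
    (hy : X.subgroup ≤ MulAction.stabilizer G y) :
    ∃ f : X ⟶ Y, toMap f ((1 : G) : X.carrier) = y := by
  let g : X.carrier → Y.carrier := fun x => Quotient.liftOn' x (fun a => a • y) (by
    intro a b hab
    rw [QuotientGroup.leftRel_apply] at hab
    have := hy hab
    rw [MulAction.mem_stabilizer_iff, mul_smul, inv_smul_eq_iff] at this
    exact this.symm)
  refine ⟨({ toFun := g, map_smul' := ?_ } : X.carrier →[G] Y.carrier), one_smul G y⟩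
  intro a x
  induction x using QuotientGroup.induction_on with
  | H b => exact mul_smul a b y

lemma subgroup_le_stabilizer {X Y : OrbitCategory G} (f : X ⟶ Y) :
    X.subgroup ≤ MulAction.stabilizer G (toMap f ((1 : G) : X.carrier)) := by
  intro a ha
  rw [← MulAction.stabilizer_quotient X.subgroup, MulAction.mem_stabilizer_iff] at ha
  rw [MulAction.mem_stabilizer_iff, ← map_smul]
  exact congrArg _ ha

/-- A sieve is a sipp-sieve if and only if it contains all morphisms from the `G ⧸ P` with `P` a
`p`-subgroup. -/
lemma isSippSieve_iff [Finite G] (p : ℕ) [Fact p.Prime] {X : OrbitCategory G} (S : Sieve X) :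
    IsSippSieve p S ↔
      ∀ (Y : OrbitCategory G) (f : Y ⟶ X), IsPGroup p Y.subgroup → S f := by
  have hp : p.Prime := Fact.out
  constructor
  · intro hS Y f hY
    obtain ⟨⟨⟨Z, g⟩, hg⟩, v, hv, hcop⟩ := hS (toMap f ((1 : G) : Y.carrier))
    set u := toMap f ((1 : G) : Y.carrier) with hu
    let A := MulAction.stabilizer G u
    let B := MulAction.stabilizer G v
    have hYA : Y.subgroup ≤ A := subgroup_le_stabilizer f
    let Q : Subgroup A := Y.subgroup.subgroupOf A
    have hQ : IsPGroup p Q := hY.comap_subtype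
    obtain ⟨q, hq⟩ := hQ.nonempty_fixed_point_of_prime_not_dvd_card (A ⧸ B.subgroupOf A)
      (fun h => (hp.coprime_iff_not_dvd.1 hcop) h)
    obtain ⟨a, rfl⟩ := QuotientGroup.mk_surjective q
    have hw : Y.subgroup ≤ MulAction.stabilizer G ((a : G) • v) := by
      intro y hy
      have h1 := hq ⟨⟨y, hYA hy⟩, hy⟩
      have h2 : (((⟨y, hYA hy⟩ : A) * a : A) : A ⧸ B.subgroupOf A) = (a : A ⧸ B.subgroupOf A) := h1
      rw [eq_comm, QuotientGroup.eq, Subgroup.mem_subgroupOf] at h2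
      have h3 : ((a : G)⁻¹ * (y * a)) • v = v := h2
      rw [MulAction.mem_stabilizer_iff, smul_smul]
      rwa [mul_smul, inv_smul_eq_iff] at h3
    obtain ⟨h, hh⟩ := exists_hom (X := Y) (Y := Z) ((a : G) • v) hw
    have : f = h ≫ g := by
      refine hom_ext ?_
      have e : toMap (h ≫ g) ((1 : G) : Y.carrier)
        = toMap g (toMap h ((1 : G) : Y.carrier)) := rfl
      have hv' : toMap g v = u := hv
      rw [e, hh, map_smul, hv']
      exact a.2.symm
    rw [this]
    exact S.downward_closed hg h
  · intro hS u
    obtain ⟨P⟩ := (inferInstance : Nonempty (Sylow p (MulAction.stabilizer G u)))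
    let Y : OrbitCategory G := ⟨(P : Subgroup (MulAction.stabilizer G u)).map (Subgroup.subtype _)⟩
    obtain ⟨f, hf⟩ := exists_hom (X := Y) (Y := X) u (Subgroup.map_subtype_le _)
    have hY : IsPGroup p Y.subgroup := P.2.map _
    refine ⟨⟨⟨Y, f⟩, hS Y f hY⟩, ((1 : G) : Y.carrier), hf, ?_⟩
    have e : MulAction.stabilizer G (((1 : G) : Y.carrier)) = Y.subgroup :=
      MulAction.stabilizer_quotient Y.subgroup
    change p.Coprime ((MulAction.stabilizer G (((1 : G) : Y.carrier))).relIndex _)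
    rw [e, hp.coprime_iff_not_dvd, Subgroup.relIndex, Subgroup.subgroupOf,
      Subgroup.comap_map_eq_self_of_injective (Subgroup.subtype_injective _)]
    exact P.not_dvd_index

/-- The sipp-topology on the orbit category. -/
def sippTopology (G : Type u) [Group G] [Finite G] (p : ℕ) [Fact p.Prime] :
    GrothendieckTopology (OrbitCategory G) where
  sieves _ := {S | IsSippSieve p S}
  top_mem' X := (isSippSieve_iff p _).2 fun _ _ _ => trivial
  pullback_stable' X Y S f hS := by
    rw [Set.mem_ofPred_eq, isSippSieve_iff] at hS ⊢
    exact fun Z g hZ => hS Z (g ≫ f) hZ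
  transitive' X S hS R hR := by
    rw [Set.mem_ofPred_eq, isSippSieve_iff] at hS ⊢
    intro Y f hY
    have h := (isSippSieve_iff p _).1 (hR (hS Y f hY)) Y (𝟙 Y) hY
    simpa using h

/-- The objects `G ⧸ P` with `P` a non-trivial `p`-subgroup of `G`. -/
def isNontrivialPOrbit (G : Type u) [Group G] (p : ℕ) : ObjectProperty (OrbitCategory G) :=
  fun X => IsPGroup p X.subgroup ∧ X.subgroup ≠ ⊥

end OrbitCategory

/-- The category `𝒪ₚ°(G)`: the full subcategory of the orbit category on the orbits `G ⧸ P` with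
`P` a non-trivial `p`-subgroup. -/
abbrev NontrivialPOrbitCategory (G : Type u) [Group G] (p : ℕ) : Type u :=
  (OrbitCategory.isNontrivialPOrbit G p).FullSubcategory

namespace NontrivialPOrbitCategory

open OrbitCategory

variable (G : Type u) [Group G] (p : ℕ)

/-- The inclusion functor `ι : 𝒪ₚ°(G) ⥤ 𝒪(G)`. -/
abbrev incl : NontrivialPOrbitCategory G p ⥤ OrbitCategory G :=
  (isNontrivialPOrbit G p).ι

variable [Finite G] [Fact p.Prime]

/-- The inclusion is cocontinuous for the minimal topology on `𝒪ₚ°(G)` and the sipp-topology. -/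
instance : (incl G p).IsCocontinuous ⊥ (sippTopology G p) where
  cover_lift {U S} hS := by
    rw [GrothendieckTopology.bot_covering, ← Sieve.id_mem_iff_eq_top]
    have h := (isSippSieve_iff p S).1 hS _ (𝟙 _) U.property.1
    change S.arrows ((incl G p).map (𝟙 U))
    rwa [CategoryTheory.Functor.map_id]

/-- The direct image functor `𝕀_* = RK_ι : PSh(𝒪ₚ°(G), Ab) ⥤ Sh(𝒪(G), J_sipp, Ab)` of the geometric
morphism induced by the inclusion: it sends an abelian presheaf, viewed as a sheaf for the minimal
topology, to its right Kan extension along the inclusion, which is a sheaf. -/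
noncomputable def directImage :
    ((NontrivialPOrbitCategory G p)ᵒᵖ ⥤ AddCommGrpCat.{u}) ⥤
      Sheaf (sippTopology G p) AddCommGrpCat.{u} :=
  (sheafBotEquivalence AddCommGrpCat.{u}).inverse ⋙
    (incl G p).sheafPushforwardCocontinuous AddCommGrpCat.{u} ⊥ (sippTopology G p)

/-- The composite of `𝕀_*` with the inclusion of sheaves into presheaves is the right Kan
extension functor along the inclusion `ι`. -/
noncomputable def directImageCompSheafToPresheaf :
    directImage G p ⋙ sheafToPresheaf _ _ ≅ (incl G p).op.ran := Iso.refl _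

instance : (directImage G p).Additive where
  map_add {X Y f g} := by
    have : ((Functor.whiskeringLeft _ _ AddCommGrpCat.{u}).obj (incl G p).op).Additive :=
      ⟨fun {_ _ _ _} => rfl⟩
    have h : ((incl G p).op.ran : _ ⥤ (_ ⥤ AddCommGrpCat.{u})).Additive :=
      ((incl G p).op.ranAdjunction AddCommGrpCat.{u}).right_adjoint_additive
    apply (sheafToPresheaf (sippTopology G p) AddCommGrpCat.{u}).map_injective
    exact h.map_add

/-- There are enough injective abelian presheaves on `𝒪ₚ°(G)`, so that the right derived functors
below make sense. -/
instance : EnoughInjectives ((NontrivialPOrbitCategory G p)ᵒᵖ ⥤ AddCommGrpCat.{u}) :=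
  (sheafBotEquivalence AddCommGrpCat.{u}).enoughInjectives_iff.1 inferInstance

/-- The higher direct image functors `Rʲ𝕀_*`, the right derived functors of `𝕀_*`. -/
noncomputable abbrev higherDirectImage (j : ℕ) :
    ((NontrivialPOrbitCategory G p)ᵒᵖ ⥤ AddCommGrpCat.{u}) ⥤
      Sheaf (sippTopology G p) AddCommGrpCat.{u} :=
  (directImage G p).rightDerived j

end NontrivialPOrbitCategory

/-!
The direct image functor is exact, so `R¹𝕀_*` vanishes, and so does its cohomology in all degrees.

Right Kan extension is a right adjoint and limits of sheaves are computed on presheaves, so `𝕀_*` is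
left exact; what has to be shown is that it preserves epimorphisms. The morphisms from the orbits
`G ⧸ P` with `P` a `p`-subgroup form a sipp-covering (`OrbitCategory.isSippSieve_iff`), so a
morphism of sheaves that is surjective on those orbits is an epimorphism
(`isLocallySurjective_of_surjective_on_pOrbits`). On those orbits, the right Kan extension of `M`
along `ι` is an extension by zero:
* on `G ⧸ P` with `P` non-trivial, its value is `M (G ⧸ P)`, since `ι` is fully faithful;
* on `G ⧸ 1`, its value is a limit over the orbits `G ⧸ P` with `P ≠ 1` equipped with a map to
  `G ⧸ 1`. There are none, because the stabilizer of a point can only grow along a `G`-map, so the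
  value is zero (`isZero_ran_obj`).
-/

namespace CategoryTheory.Functor

open Limits

/-- The positive right derived functors of an exact functor vanish. -/
lemma isZero_rightDerived_obj_succ {C D : Type*} [Category* C] [Category* D] [Abelian C]
    [HasInjectiveResolutions C] [Abelian D] (F : C ⥤ D) [F.Additive] [F.PreservesHomology]
    (n : ℕ) (X : C) : IsZero ((F.rightDerived (n + 1)).obj X) := by
  let I := injectiveResolution X
  refine IsZero.of_iso ?_ (I.isoRightDerivedObj F (n + 1))
  have h := (I.exact_succ n).map F
  rw [HomologicalComplex.homologyFunctor_obj, ← HomologicalComplex.exactAt_iff_isZero_homology,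
    HomologicalComplex.exactAt_iff' _ n (n + 1) (n + 2) (by simp) (by simp)]
  exact h

end CategoryTheory.Functor

namespace NontrivialPOrbitCategory

open OrbitCategory Limits Opposite

variable (G : Type u) [Group G] (p : ℕ)

/-- The right Kan extension along `ι` vanishes on the free orbit: no orbit with non-trivial
stabilizers maps to it. -/
lemma isZero_ran_obj (M : (NontrivialPOrbitCategory G p)ᵒᵖ ⥤ AddCommGrpCat.{u})
    (X : OrbitCategory G) (hX : X.subgroup = ⊥) :
    IsZero (((incl G p).op.ran.obj M).obj (op X)) := by
  have : IsEmpty (StructuredArrow (op X) (incl G p).op) := by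
    refine ⟨fun f => ?_⟩
    let P := f.right.unop
    obtain ⟨x, hx⟩ := QuotientGroup.mk_surjective (toMap (X := P.obj) f.hom.unop ((1 : G) : _))
    refine P.property.2 (eq_bot_iff.2 fun a ha => ?_)
    have h := subgroup_le_stabilizer (X := P.obj) f.hom.unop ha
    rw [← hx, MulAction.mem_stabilizer_iff, MulAction.Quotient.smul_mk, eq_comm,
      QuotientGroup.eq, hX, Subgroup.mem_bot, smul_eq_mul, inv_mul_eq_one] at h
    simpa using h.symm
  refine IsZero.of_iso ?_ ((incl G p).op.ranObjObjIsoLimit M (op X))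
  exact (IsZero.iff_id_eq_zero _).2 (limit.hom_ext isEmptyElim)

variable [Finite G] [Fact p.Prime]

/-- The morphisms from the orbits of `p`-subgroups cover, so surjectivity on these orbits implies
local surjectivity. -/
lemma isLocallySurjective_of_surjective_on_pOrbits
    {A B : (OrbitCategory G)ᵒᵖ ⥤ AddCommGrpCat.{u}} (f : A ⟶ B)
    (hf : ∀ X : OrbitCategory G, IsPGroup p X.subgroup → Function.Surjective (f.app (op X))) :
    Presheaf.IsLocallySurjective (sippTopology G p) f where
  imageSieve_mem _ := (isSippSieve_iff p _).2 fun Y _ hY => hf Y hY _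

instance : (directImage G p).PreservesEpimorphisms where
  preserves {M N} f hf := by
    rw [← Sheaf.isLocallySurjective_iff_epi' (φ := (directImage G p).map f)]
    refine isLocallySurjective_of_surjective_on_pOrbits G p _ fun X hX => ?_
    change Function.Surjective (((incl G p).op.ran.map f).app (op X))
    by_cases h : X.subgroup = ⊥
    · have := AddCommGrpCat.subsingleton_of_isZero (isZero_ran_obj G p N X h)
      exact fun y => ⟨0, Subsingleton.elim _ _⟩
    · -- The counit `ι* RK_ι ⟶ 𝟭` is invertible, which identifies the component of `RK_ι f` at `X`
      -- with the component of the epimorphism `f`.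
      let P : NontrivialPOrbitCategory G p := ⟨X, hX, h⟩
      rw [← AddCommGrpCat.epi_iff_surjective]
      have e := congr_app ((incl G p).op.ranCounit.naturality f) (op P)
      have e' := (IsIso.eq_comp_inv (((incl G p).op.ranCounit.app N).app (op P))).2 e
      change Epi ((((incl G p).op.ran ⋙
        (Functor.whiskeringLeft _ _ AddCommGrpCat.{u}).obj (incl G p).op).map f).app (op P))
      rw [e']
      infer_instance

instance : PreservesFiniteLimits (directImage G p) := by
  have : PreservesLimitsOfSize.{0, 0} ((incl G p).op.ran : _ ⥤ (_ ⥤ AddCommGrpCat.{u})) :=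
    ((incl G p).op.ranAdjunction AddCommGrpCat.{u}).rightAdjoint_preservesLimits
  have : PreservesFiniteLimits (directImage G p ⋙ sheafToPresheaf _ _) :=
    inferInstanceAs (PreservesFiniteLimits (incl G p).op.ran)
  exact ⟨fun _ _ _ => preservesLimitsOfShape_of_reflects_of_preserves _ (sheafToPresheaf _ _)⟩

instance : (directImage G p).PreservesHomology := by
  refine ((directImage G p).exact_tfae.out 0 2).1 fun S hS => ?_
  have h := (directImage G p).preservesFiniteLimits_iff_forall_exact_map_and_mono.1 inferInstance
    S hS
  have := hS.epi_g
  have : Mono (S.map (directImage G p)).f := h.2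
  have : Epi (S.map (directImage G p)).g := inferInstanceAs (Epi ((directImage G p).map S.g))
  exact ⟨h.1⟩

end NontrivialPOrbitCategory

theorem corollary6p3p1 (G : Type u) [Group G] [Finite G] (p : ℕ) [Fact p.Prime]
    (M : (NontrivialPOrbitCategory G p)ᵒᵖ ⥤ AddCommGrpCat.{u}) :
    Subsingleton
        (((NontrivialPOrbitCategory.higherDirectImage G p 1).obj M).H 0) ∧
      Subsingleton
        (((NontrivialPOrbitCategory.higherDirectImage G p 1).obj M).H 1) := by
  have h := (NontrivialPOrbitCategory.directImage G p).isZero_rightDerived_obj_succ 0 M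
  exact ⟨Sheaf.subsingleton_H_of_isZero h 0, Sheaf.subsingleton_H_of_isZero h 1⟩
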